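/- Let $p=p(n)\in[0,1]$. Choose $n$ points independently and uniformly at random in the unit square $[0,1]^2$ and, independently, join each pair of points by an edge with probability $p$, independently of all other pairs; let $G$ be the resulting geometric graph. For vertices $u,v$ let $d(u,v)$ be their Euclidean distance and $d_G(u,v)$ the length of a shortest path between them in $G$, where each edge has weight equal to its Euclidean length. If $G$ is connected, its stretch factor is $\mathcal F(n,p)=\max_{u\neq v} d_G(u,v)/d(u,v)$; if $G$ is disconnected, the stretch factor is undefined (infinite). Let $\mathrm{CON}$ be the event that $G$ is connected. A property holds asymptotically almost surely (a.a.s.) if its probability tends to $1$ as $n\to\infty$. 1. If $p^2n\ge 33\log n$ for all sufficiently large $n$ and $w(n)\to\infty$, then a.a.s. $G$ is connected and $$\mathcal F(n,p)\le 1+\frac{w(n)\sqrt{n(1-p)}}{p}.$$ 2. If $p^2n\ge 113\log n$ for all sufficiently large $n$, then, as $n\to\infty$, $$\mathbf E[\mathcal F(n,p)\mid \mathrm{CON}]\le 1+\frac{\sqrt{2048\,n(1-p)}}{p}+o(1),$$ where $\mathrm{CON}$ has positive probability for all sufficiently large $n$. 3. In particular, if $n(1-p)\to 0$, then for every fixed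 $\varepsilon>0$ a.a.s. $G$ is connected and $\mathcal F(n,p)<1+\varepsilon$, and for all sufficiently large $n$ the event $\mathrm{CON}$ has positive probability and $\mathbf E[\mathcal F(n,p)\mid \mathrm{CON}]\le 1+\varepsilon$. -/

import Mathlib

open MeasureTheory ProbabilityTheory Filter Topology
open scoped ENNReal

noncomputable section

namespace RandomEmbeddedGraph

/-- The Euclidean plane. -/
abbrev Plane : Type := EuclideanSpace ℝ (Fin 2)

/-- The unit square `[0,1]²`. -/
def unitSquare : Set Plane := {z | ∀ i, z i ∈ Set.Icc (0 : ℝ) 1}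

/-- The Euclidean length of a walk in a graph whose vertices are embedded in the plane by `x`:
the sum of the distances between the end points of its edges, with multiplicity. -/
def walkLength {V : Type*} {G : SimpleGraph V} (x : V → Plane) {u v : V} (w : G.Walk u v) : ℝ≥0∞ :=
  (w.darts.map fun e => edist (x e.fst) (x e.snd)).sum

/-- The shortest-path distance `d_G(u,v)` in the graph `G` embedded by `x`
(it is `∞` if `u` and `v` lie in different components). -/
def graphDist {V : Type*} (x : V → Plane) (G : SimpleGraph V) (u v : V) : ℝ≥0∞ :=
  ⨅ w : G.Walk u v, walkLength x w

/-- The stretch factor of the graph `G` embedded by `x`: the largest ratio `d_G(u,v) / d(u,v)` over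
all pairs of distinct vertices. On a disconnected graph, where the stretch factor
is undefined, this expression has the value `∞`. -/
def stretchFactor {V : Type*} (x : V → Plane) (G : SimpleGraph V) : ℝ≥0∞ :=
  ⨆ (u : V) (v : V) (_ : u ≠ v), graphDist x G u v / edist (x u) (x v)

/-- A sample point: the positions of the `n` vertices, and the graph on them. -/
abbrev Sample (n : ℕ) : Type := (Fin n → Plane) × SimpleGraph (Fin n)

/-- The law of the randomly embedded random graph: `n` independent uniform points of the unit
square (whose area is `1`) and, independently of them, a binomial random graph `G(n,p)`. -/
def law (n : ℕ) (p : unitInterval) : Measure (Sample n) :=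
  (Measure.pi fun _ : Fin n => (volume : Measure Plane).restrict unitSquare).prod
    (SimpleGraph.binomialRandom (Fin n) p)

/-- The stretch factor `F(n,p)` as a random variable on the sample space. -/
def F {n : ℕ} (ω : Sample n) : ℝ≥0∞ := stretchFactor ω.1 ω.2

/-- The event that the graph is connected. -/
def CON (n : ℕ) : Set (Sample n) := {ω | ω.2.Connected}

/-- `E n` holds asymptotically almost surely for the random graphs with parameters `n`, `p n`. -/
def AAS (p : ℕ → unitInterval) (E : ∀ n, Set (Sample n)) : Prop :=
  Tendsto (fun n => law n (p n) (E n)) atTop (𝓝 1)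

/-- The conditional expectation `E[F(n,p) | CON]` of the stretch factor, given that the graph is
connected, as an element of `[0,∞]`. -/
def expectationGivenCON (n : ℕ) (p : unitInterval) : ℝ≥0∞ :=
  ∫⁻ ω, F ω ∂(ProbabilityTheory.cond (law n p) (CON n))

end RandomEmbeddedGraph

end

/-! An edge has stretch at most 1. For a nonadjacent pair `u`, `v`, a detour through a common
neighbour `w` costs at most `d(u,v) + 2 d(w,u)`, so stretch above `1 + t` forces every common
neighbour to lie further than `t d(u,v) / 2` from `u`. A uniform point does so with probability at
most `exp(-t² d(u,v)² / 8)`. With `k` common neighbours these factors multiply, and integrating the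
resulting Gaussian over the position of `v` gives `8π / (t² k)` (`posLaw_farEvent_le`).

A Chernoff bound shows that, outside an event of probability `O(n⁻⁵)`, every pair has at least `p² n
/ 8` common neighbours (`binomialRandom_compl_manyCommonNbrs_le_of_log_le`); this also gives
connectedness. The expected number of nonadjacent ordered pairs is at most `n² (1 - p)`, so a union
bound leaves the tail `64π n(1-p) / (p² t²)`. Taking `t = w √(n(1-p)) / p` yields the bound in
probability.

Integrating the quadratic tail yields the expectation. Exceptional connected graphs only have the
crude bound `O(n⁴)`, coming from the closest pair of points, and their probability reduces it to
`O(1/n)`. The case of few missing edges follows from both bounds, since then `p ≥ 1/2` eventually.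
-/

noncomputable section

namespace RandomEmbeddedGraph

/-! ### Two integration tools: resampling one coordinate, and integrating a quadratic tail. -/

section

/-- Integrating out one coordinate of a product of probability measures. -/
theorem lintegral_pi_le_of_update {ι : Type*} [Fintype ι] [DecidableEq ι] {X : ι → Type*}
    [∀ i, MeasurableSpace (X i)] (μ : ∀ i, Measure (X i)) [∀ i, IsProbabilityMeasure (μ i)]
    (i : ι) {f g : (∀ i, X i) → ℝ≥0∞} (hf : Measurable f)
    (h : ∀ᵐ x ∂Measure.pi μ, ∫⁻ y, f (Function.update x i y) ∂μ i ≤ g x) :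
    ∫⁻ x, f x ∂Measure.pi μ ≤ ∫⁻ x, g x ∂Measure.pi μ := by
  have hm : Measurable (∫⋯∫⁻_{i}, f ∂μ) := hf.lmarginal μ
  have key : ∫⁻ x, f x ∂Measure.pi μ = ∫⁻ x, (∫⋯∫⁻_{i}, f ∂μ) x ∂Measure.pi μ := by
    refine lintegral_eq_of_lmarginal_eq {i} hf hm ?_
    ext x
    conv_rhs => rw [lmarginal_singleton]
    simp [lmarginal_update_of_mem]
  rw [key, lmarginal_singleton]
  exact lintegral_mono_ae h

/-- A function whose tail decays quadratically has a small integral. -/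
theorem lintegral_le_of_tail {α : Type*} [MeasurableSpace α] {μ : Measure α}
    [IsProbabilityMeasure μ] {f : α → ℝ≥0∞} (hf : Measurable f) {C s : ℝ} (hs : 0 < s)
    (hC : 0 ≤ C)
    (h : ∀ t : ℝ, 0 < t → μ {a | ENNReal.ofReal (1 + t) < f a} ≤ ENNReal.ofReal (C / t ^ 2)) :
    ∫⁻ a, f a ∂μ ≤ 1 + ENNReal.ofReal (s + C / s) := by
  -- Needed because `toReal` sends `∞` to `0`; letting `t → ∞` in the tail bound gives it.
  have htop : ∀ᵐ a ∂μ, f a ≠ ∞ := by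
    rw [ae_iff]
    have hlim : Tendsto (fun t : ℝ => ENNReal.ofReal (C / t ^ 2)) atTop (𝓝 0) := by
      rw [← ENNReal.ofReal_zero]
      exact ENNReal.tendsto_ofReal
        (tendsto_const_nhds.div_atTop (tendsto_pow_atTop (two_ne_zero)))
    refine le_antisymm (ge_of_tendsto hlim ?_) zero_le
    filter_upwards [eventually_gt_atTop 0] with t ht
    refine (measure_mono fun a ha => ?_).trans (h t ht)
    have : f a = ∞ := by simpa using ha
    simp [this]
  have hle : ∫⁻ a, f a ∂μ ≤ ∫⁻ a, 1 + ENNReal.ofReal ((f a - 1).toReal) ∂μ := by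
    refine lintegral_mono_ae ?_
    filter_upwards [htop] with a ha
    rw [ENNReal.ofReal_toReal (ENNReal.sub_ne_top ha)]
    exact le_add_tsub
  refine hle.trans ?_
  rw [lintegral_add_left measurable_const]
  simp only [lintegral_const, measure_univ, mul_one]
  gcongr
  rw [lintegral_eq_lintegral_meas_lt μ (Eventually.of_forall fun _ => ENNReal.toReal_nonneg)
    (by fun_prop)]
  have htail : ∀ t : ℝ, 0 < t →
      μ {a | t < (f a - 1).toReal} ≤ ENNReal.ofReal (C / t ^ 2) := by
    intro t ht
    refine (measure_mono fun a ha => ?_).trans (h t ht)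
    have h1 : ENNReal.ofReal t < f a - 1 := ENNReal.ofReal_lt_iff_lt_toReal ht.le
      (fun h0 => by simp [h0] at ha; linarith) |>.2 ha
    have h2 := lt_tsub_iff_left.1 h1
    show ENNReal.ofReal (1 + t) < f a
    rwa [ENNReal.ofReal_add zero_le_one ht.le, ENNReal.ofReal_one]
  -- Up to `s` the tail is bounded by 1, beyond `s` by `C / t²`, whose integral is `C / s`.
  rw [← Set.Ioc_union_Ioi_eq_Ioi hs.le, ENNReal.ofReal_add hs.le (by positivity)]
  refine (lintegral_union_le _ _ _).trans (add_le_add ?_ ?_)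
  · refine (lintegral_mono (g := fun _ => 1) fun t => prob_le_one).trans ?_
    simp
  · have h1 : ∫⁻ t in Set.Ioi s, μ {a | t < (f a - 1).toReal} ≤
        ∫⁻ t in Set.Ioi s, ENNReal.ofReal (C * t ^ (-2 : ℝ)) := by
      refine setLIntegral_mono' measurableSet_Ioi fun t ht => (htail t (hs.trans ht)).trans ?_
      rw [Real.rpow_neg (hs.trans ht).le, div_eq_mul_inv]
      norm_cast
    refine h1.trans ?_
    rw [← ofReal_integral_eq_lintegral_ofReal
      ((integrableOn_Ioi_rpow_of_lt (by norm_num) hs).const_mul C)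
      ((ae_restrict_iff' measurableSet_Ioi).2 (Eventually.of_forall fun t ht =>
        mul_nonneg hC (Real.rpow_nonneg (hs.trans ht).le _))), integral_const_mul,
      integral_Ioi_rpow_of_lt (by norm_num) hs]
    refine ENNReal.ofReal_le_ofReal (le_of_eq ?_)
    norm_num
    rw [Real.rpow_neg_one]
    ring

end

/-! ### Deterministic bounds on the stretch of an embedded graph. -/

section

variable {V : Type*} {G : SimpleGraph V} (x : V → Plane)

theorem graphDist_le_edist_of_adj {u v : V} (h : G.Adj u v) :
    graphDist x G u v ≤ edist (x u) (x v) :=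
  iInf_le_of_le h.toWalk (by simp [walkLength])

theorem graphDist_le_of_common_neighbor {u v w : V} (hu : G.Adj u w) (hv : G.Adj v w) :
    graphDist x G u v ≤ edist (x u) (x w) + edist (x w) (x v) :=
  iInf_le_of_le (.cons hu hv.symm.toWalk) (by simp [walkLength])

theorem graphDist_div_le_of_common_neighbor {u v w : V} (hu : G.Adj u w) (hv : G.Adj v w)
    {t : ℝ} (ht : 0 ≤ t) (h : 2 * dist (x w) (x u) ≤ t * dist (x u) (x v)) :
    graphDist x G u v / edist (x u) (x v) ≤ ENNReal.ofReal (1 + t) := by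
  refine ENNReal.div_le_of_le_mul ((graphDist_le_of_common_neighbor x hu hv).trans ?_)
  rw [edist_dist, edist_dist, edist_dist, ← ENNReal.ofReal_add dist_nonneg dist_nonneg,
    ← ENNReal.ofReal_mul (by positivity)]
  refine ENNReal.ofReal_le_ofReal ?_
  have := dist_triangle (x w) (x u) (x v)
  rw [dist_comm (x u) (x w)]
  linarith

open Classical in
/-- The common neighbours of two vertices. -/
def commonNbrs [Fintype V] (G : SimpleGraph V) (u v : V) : Finset V :=
  {w | G.Adj u w ∧ G.Adj v w}

theorem mem_commonNbrs [Fintype V] {u v w : V} :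
    w ∈ commonNbrs G u v ↔ G.Adj u w ∧ G.Adj v w := by
  simp [commonNbrs]

theorem exists_of_lt_stretchFactor [Fintype V] {t : ℝ} (ht : 0 ≤ t)
    (h : ENNReal.ofReal (1 + t) < stretchFactor x G) :
    ∃ u v, u ≠ v ∧ ¬ G.Adj u v ∧
      ∀ w ∈ commonNbrs G u v, t * dist (x u) (x v) < 2 * dist (x w) (x u) := by
  simp only [stretchFactor, lt_iSup_iff] at h
  obtain ⟨u, v, huv, h⟩ := h
  refine ⟨u, v, huv, fun hadj => ?_, fun w hw => ?_⟩
  · refine absurd h (not_lt.2 ?_)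
    refine ENNReal.div_le_of_le_mul ((graphDist_le_edist_of_adj x hadj).trans ?_)
    refine le_mul_of_one_le_left zero_le ?_
    simp [ht]
  · rw [mem_commonNbrs] at hw
    by_contra! hle
    exact absurd h (not_lt.2 (graphDist_div_le_of_common_neighbor x hw.1 hw.2 ht hle))

theorem dist_le_two {y z : Plane} (hy : y ∈ unitSquare) (hz : z ∈ unitSquare) :
    dist y z ≤ 2 := by
  rw [EuclideanSpace.dist_eq, Fin.sum_univ_two]
  refine Real.sqrt_le_iff.2 ⟨by norm_num, ?_⟩
  have h (i : Fin 2) : dist (y i) (z i) ≤ 1 := by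
    obtain ⟨a, b⟩ := hy i
    obtain ⟨c, d⟩ := hz i
    rw [Real.dist_eq, abs_le]
    constructor <;> linarith
  have h0 := h 0
  have h1 := h 1
  nlinarith [dist_nonneg (x := y 0) (y := z 0), dist_nonneg (x := y 1) (y := z 1)]

/-- A path has fewer edges than there are vertices, and each edge has length at most 2. -/
theorem graphDist_le_of_connected [Fintype V] (hG : G.Connected)
    (hx : ∀ v, x v ∈ unitSquare) (u v : V) :
    graphDist x G u v ≤ ENNReal.ofReal (2 * Fintype.card V) := by
  obtain ⟨w, hw⟩ := (hG.preconnected u v).exists_isPath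
  refine iInf_le_of_le w ?_
  have h1 : walkLength x w ≤ w.length • (2 : ℝ≥0∞) := by
    refine (List.sum_le_card_nsmul _ 2 ?_).trans (by simp)
    intro a ha
    obtain ⟨e, -, rfl⟩ := List.mem_map.1 ha
    rw [edist_dist]
    refine ENNReal.ofReal_le_of_le_toReal ?_
    simpa using dist_le_two (hx _) (hx _)
  refine h1.trans ?_
  rw [ENNReal.ofReal_mul (by norm_num), mul_comm, nsmul_eq_mul]
  simp only [ENNReal.ofReal_natCast, ENNReal.ofReal_ofNat]
  gcongr
  exact hw.length_lt.le

theorem exists_of_lt_stretchFactor_of_connected [Fintype V] (hG : G.Connected)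
    (hx : ∀ v, x v ∈ unitSquare) {t : ℝ} (ht : 0 < t)
    (h : ENNReal.ofReal (1 + t) < stretchFactor x G) :
    ∃ u v, u ≠ v ∧ dist (x v) (x u) < 2 * Fintype.card V / t := by
  simp only [stretchFactor, lt_iSup_iff] at h
  obtain ⟨u, v, huv, h⟩ := h
  refine ⟨u, v, huv, ?_⟩
  by_contra! hle
  refine absurd h (not_lt.2 (ENNReal.div_le_of_le_mul
    ((graphDist_le_of_connected x hG hx u v).trans ?_)))
  rw [edist_dist, ← ENNReal.ofReal_mul (by positivity), dist_comm]
  refine ENNReal.ofReal_le_ofReal ?_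
  rw [div_le_iff₀ ht] at hle
  nlinarith [dist_nonneg (x := x v) (y := x u)]

theorem connected_of_commonNbrs_nonempty [Fintype V] [Nonempty V]
    (h : ∀ u v, u ≠ v → (commonNbrs G u v).Nonempty) : G.Connected := by
  refine (SimpleGraph.connected_iff _).2 ⟨fun u v => ?_, inferInstance⟩
  by_cases huv : u = v
  · exact huv ▸ .rfl
  · obtain ⟨w, hw⟩ := h u v huv
    rw [mem_commonNbrs] at hw
    exact hw.1.reachable.trans hw.2.symm.reachable

/-- A walk is determined by its list of vertices, so the infimum over walks is countable. -/
theorem measurable_stretchFactor [Countable V] (G : SimpleGraph V) :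
    Measurable fun x : V → Plane => stretchFactor x G := by
  have hc (u v : V) : Countable (G.Walk u v) :=
    Function.Injective.countable (f := fun w : G.Walk u v => w.support)
      fun _ _ h => SimpleGraph.Walk.ext_support h
  unfold stretchFactor graphDist walkLength
  refine .iSup fun u => .iSup fun v => .iSup fun _ => .div (.iInf fun w => ?_) ?_
  · induction w.darts with
    | nil => simp
    | cons a l ih =>
      simp only [List.map_cons, List.sum_cons]
      exact .add (by fun_prop) ih
  · fun_prop

end

/-! ### Uniform points of the unit square. -/

section

/-- The uniform distribution on the unit square. -/
abbrev uniform : Measure Plane := (volume : Measure Plane).restrict unitSquare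

theorem volume_box (s : Fin 2 → Set ℝ) :
    (volume : Measure Plane) {z | ∀ i, z i ∈ s i} = volume (s 0) * volume (s 1) := by
  have h := (EuclideanSpace.volume_preserving_symm_measurableEquiv_toLp (Fin 2)).measure_preimage_equiv
    (Set.univ.pi s)
  rw [volume_pi_pi, Fin.prod_univ_two] at h
  rw [← h]
  congr 1
  ext z
  simp

theorem measurableSet_box {s : Fin 2 → Set ℝ} (hs : ∀ i, MeasurableSet (s i)) :
    MeasurableSet {z : Plane | ∀ i, z i ∈ s i} := by
  have : {z : Plane | ∀ i, z i ∈ s i} = ⋂ i, (fun z : Plane => z i) ⁻¹' s i := by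
    ext; simp
  rw [this]
  exact .iInter fun i => (by fun_prop : Measurable fun z : Plane => z i) (hs i)

theorem measurableSet_unitSquare : MeasurableSet unitSquare :=
  measurableSet_box fun _ => measurableSet_Icc

instance : IsProbabilityMeasure uniform where
  measure_univ := by
    rw [Measure.restrict_apply_univ]
    exact (volume_box fun _ => Set.Icc 0 1).trans (by simp)

theorem uniform_ball_le (z : Plane) (r : ℝ) :
    uniform {y | dist y z < r} ≤ ENNReal.ofReal (Real.pi * r ^ 2) := by
  refine (Measure.restrict_apply_le _ _).trans ?_
  rcases le_total r 0 with hr | hr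
  · have : {y | dist y z < r} = ∅ := by
      ext y
      simpa using hr.trans dist_nonneg
    simp [this]
  · refine (EuclideanSpace.volume_ball_fin_two z r).le.trans ?_
    rw [← ENNReal.ofReal_pow hr, ← ENNReal.ofReal_mul (by positivity), mul_comm]

/-- Shrinking the square towards `z` by the factor `s = min 1 (r / √2)` gives a box inside the
square, of area `s²` and diameter at most `r`, that contains `z`. Points further than `r` from `z`
avoid it, and `1 - r² / 2 ≤ exp(-r² / 2)`. This works even for `z` at a corner. -/
theorem uniform_compl_closedBall_le {z : Plane} (hz : z ∈ unitSquare) {r : ℝ} (hr : 0 ≤ r) :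
    uniform {y | r < dist y z} ≤ ENNReal.ofReal (Real.exp (-(r ^ 2 / 2))) := by
  set s := min 1 (r / √2) with hs
  have h2 : (√2) ^ 2 = 2 := Real.sq_sqrt (by norm_num)
  have hs0 : 0 ≤ s := by positivity
  have hs1 : s ≤ 1 := min_le_left _ _
  have hsr : 2 * s ^ 2 ≤ r ^ 2 := by
    have : s ≤ r / √2 := min_le_right _ _
    have h := pow_le_pow_left₀ hs0 this 2
    rw [div_pow, h2] at h
    linarith
  set S : Fin 2 → Set ℝ := fun i => Set.Icc (z i * (1 - s)) (z i * (1 - s) + s) with hS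
  have hvol : uniform {y : Plane | ∀ i, y i ∈ S i} = ENNReal.ofReal (s ^ 2) := by
    rw [Measure.restrict_eq_self, volume_box]
    · simp [hS, ← ENNReal.ofReal_mul hs0, sq]
    · intro y hy i
      obtain ⟨a, b⟩ := hy i
      obtain ⟨c, d⟩ := hz i
      constructor <;> nlinarith
  have hsub : {y | r < dist y z} ⊆ {y : Plane | ∀ i, y i ∈ S i}ᶜ := by
    intro y hy hy'
    have hi (i : Fin 2) : dist (y i) (z i) ^ 2 ≤ s ^ 2 := by
      obtain ⟨a, b⟩ := hy' i
      obtain ⟨c, d⟩ := hz i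
      rw [Real.dist_eq, sq_abs]
      refine sq_le_sq' ?_ ?_ <;> nlinarith
    have : dist y z ≤ r := by
      rw [EuclideanSpace.dist_eq, Fin.sum_univ_two]
      refine Real.sqrt_le_iff.2 ⟨hr, ?_⟩
      linarith [hi 0, hi 1]
    exact absurd hy (not_lt.2 this)
  have hm : MeasurableSet {y : Plane | ∀ i, y i ∈ S i} :=
    measurableSet_box fun _ => measurableSet_Icc
  rcases le_or_gt r (√2) with hr2 | hr2
  · have hse : s ^ 2 = r ^ 2 / 2 := by
      rw [hs, min_eq_right ((div_le_one (by positivity)).2 hr2), div_pow, h2]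
    refine (measure_mono hsub).trans ?_
    rw [prob_compl_eq_one_sub hm, hvol, ← ENNReal.ofReal_one, ← ENNReal.ofReal_sub _ (by positivity),
      hse]
    exact ENNReal.ofReal_le_ofReal (by linarith [Real.add_one_le_exp (-(r ^ 2 / 2))])
  · have hse : s = 1 := min_eq_left ((one_le_div (by positivity)).2 hr2.le)
    refine (measure_mono hsub).trans ?_
    rw [prob_compl_eq_one_sub hm, hvol, hse]
    simp

theorem lintegral_gaussian {b : ℝ} (hb : 0 < b) (z : Plane) :
    ∫⁻ y : Plane, ENNReal.ofReal (Real.exp (-(b * dist z y ^ 2))) = ENNReal.ofReal (Real.pi / b) := by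
  have h := GaussianFourier.integral_rexp_neg_mul_sq_norm (V := Plane) hb
  have hi : Integrable fun y : Plane => Real.exp (-b * ‖y‖ ^ 2) :=
    .of_integral_ne_zero (by rw [h]; positivity)
  simp only [finrank_euclideanSpace, Fintype.card_fin, Nat.cast_ofNat, div_self (two_ne_zero' ℝ),
    Real.rpow_one] at h
  rw [← h, ofReal_integral_eq_lintegral_ofReal hi (.of_forall fun _ => by positivity)]
  simp_rw [dist_comm z, dist_eq_norm, neg_mul]
  exact lintegral_sub_right_eq_self
    (fun y : Plane => ENNReal.ofReal (Real.exp (-(b * ‖y‖ ^ 2)))) z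

/-! ### Tail of the stretch factor for a fixed graph with random positions. -/

variable {V : Type*}

/-- The Gaussian factor that bounds the probability of a point being further than
`t * dist (x u) (x v) / 2` from `x u`. -/
def gaussFactor (t : ℝ) (u v : V) (x : V → Plane) : ℝ≥0∞ :=
  ENNReal.ofReal (Real.exp (-(t ^ 2 / 8 * dist (x u) (x v) ^ 2)))

/-- The event that no vertex of `W` is close to `u` compared with the distance from `u` to `v`. -/
def farEvent (t : ℝ) (u v : V) (W : Finset V) : Set (V → Plane) :=
  {x | ∀ w ∈ W, t * dist (x u) (x v) < 2 * dist (x w) (x u)}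

theorem measurable_gaussFactor (t : ℝ) (u v : V) : Measurable (gaussFactor t u v) := by
  unfold gaussFactor
  fun_prop

theorem measurableSet_farEvent (t : ℝ) (u v : V) (W : Finset V) :
    MeasurableSet (farEvent t u v W) := by
  have : farEvent t u v W = ⋂ w ∈ W, {x | t * dist (x u) (x v) < 2 * dist (x w) (x u)} := by
    ext; simp [farEvent]
  rw [this]
  exact .biInter W.countable_toSet fun w _ => measurableSet_lt (by fun_prop) (by fun_prop)

variable [Fintype V]

/-- The law of independent uniform points of the unit square indexed by `V`. -/
abbrev posLaw (V : Type*) [Fintype V] : Measure (V → Plane) := Measure.pi fun _ : V => uniform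

theorem ae_mem_unitSquare : ∀ᵐ x ∂posLaw V, ∀ v, x v ∈ unitSquare := by
  refine ae_all_iff.2 fun v => ?_
  exact (Measure.quasiMeasurePreserving_eval (fun _ : V => uniform) v).ae
    (ae_restrict_mem measurableSet_unitSquare)

open Classical in
theorem posLaw_dist_lt_le {u v : V} (huv : u ≠ v) (r : ℝ) :
    posLaw V {x | dist (x v) (x u) < r} ≤ ENNReal.ofReal (Real.pi * r ^ 2) := by
  have hm : MeasurableSet {x : V → Plane | dist (x v) (x u) < r} :=
    measurableSet_lt (by fun_prop) (by fun_prop)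
  rw [← lintegral_indicator_one hm]
  refine (lintegral_pi_le_of_update (fun _ => uniform) v
    (g := fun _ => ENNReal.ofReal (Real.pi * r ^ 2)) (measurable_one.indicator hm)
    (.of_forall fun x => ?_)).trans (by simp)
  refine le_trans (le_of_eq ?_) (uniform_ball_le (x u) r)
  rw [← lintegral_indicator_one (measurableSet_lt (by fun_prop) (by fun_prop))]
  refine lintegral_congr fun y => ?_
  simp [Set.indicator_apply, Function.update_of_ne huv]

-- Resampling the points of `W` one at a time turns each distance condition into one Gaussian
-- factor, as `x u` and `x v` stay fixed. The exponent `k` collects the factors already produced,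
-- which is what the induction needs.
open Classical in
theorem lintegral_gaussFactor_farEvent_le {t : ℝ} (ht : 0 ≤ t) {u v : V} (W : Finset V)
    (hu : u ∉ W) (hv : v ∉ W) (k : ℕ) :
    ∫⁻ x, gaussFactor t u v x ^ k * (farEvent t u v W).indicator 1 x ∂posLaw V ≤
      ∫⁻ x, gaussFactor t u v x ^ (k + W.card) ∂posLaw V := by
  induction W using Finset.induction_on generalizing k with
  | empty => simp [farEvent]
  | insert w W hw ih =>
    simp only [Finset.mem_insert, not_or] at hu hv
    have hg := measurable_gaussFactor t u v
    have hstep := lintegral_pi_le_of_update (fun _ : V => uniform) w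
      (f := fun x => gaussFactor t u v x ^ k * (farEvent t u v (insert w W)).indicator 1 x)
      (g := fun x => gaussFactor t u v x ^ (k + 1) * (farEvent t u v W).indicator 1 x)
      ((hg.pow_const k).mul (measurable_one.indicator (measurableSet_farEvent ..))) ?_
    · refine hstep.trans ((ih hu.2 hv.2 (k + 1)).trans (le_of_eq ?_))
      rw [Finset.card_insert_of_notMem hw, add_assoc, add_comm 1]
    · filter_upwards [ae_mem_unitSquare] with x hx
      have hmem (y : Plane) : (farEvent t u v (insert w W)).indicator (1 : (V → Plane) → ℝ≥0∞)
          (Function.update x w y) = (farEvent t u v W).indicator 1 x *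
            {y | t * dist (x u) (x v) / 2 < dist y (x u)}.indicator 1 y := by
        have h1 : Function.update x w y ∈ farEvent t u v (insert w W) ↔
            x ∈ farEvent t u v W ∧ t * dist (x u) (x v) / 2 < dist y (x u) := by
          simp only [farEvent, Set.mem_ofPred_eq, Finset.forall_mem_insert, Function.update_self,
            Function.update_of_ne hu.1, Function.update_of_ne hv.1]
          rw [and_comm, div_lt_iff₀' two_pos]
          refine and_congr_left fun _ => forall₂_congr fun a ha => ?_
          rw [Function.update_of_ne (show a ≠ w from fun h => hw (h ▸ ha))]
        by_cases h2 : x ∈ farEvent t u v W <;>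
          by_cases h3 : t * dist (x u) (x v) / 2 < dist y (x u) <;>
            simp only [Set.indicator_apply, h1, h2, h3, Pi.one_apply, Set.mem_ofPred_eq] <;> simp
      have hgu (y : Plane) : gaussFactor t u v (Function.update x w y) = gaussFactor t u v x := by
        simp only [gaussFactor, Function.update_of_ne hu.1, Function.update_of_ne hv.1]
      simp_rw [hmem, hgu, ← mul_assoc]
      have hms : MeasurableSet {y | t * dist (x u) (x v) / 2 < dist y (x u)} :=
        measurableSet_lt (by fun_prop) (by fun_prop)
      rw [lintegral_const_mul _ (measurable_one.indicator hms), lintegral_indicator_one hms, pow_succ,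
        mul_right_comm]
      gcongr
      refine (uniform_compl_closedBall_le (hx u) (by positivity)).trans (le_of_eq ?_)
      unfold gaussFactor
      congr 3
      ring

-- Once the points of `W` are integrated out, what is left is a Gaussian in `x v` centred at `x u`;
-- extending its integral from the square to the whole plane makes it explicit.
open Classical in
theorem posLaw_farEvent_le {t : ℝ} (ht : 0 < t) {u v : V} (huv : u ≠ v) {W : Finset V}
    (hu : u ∉ W) (hv : v ∉ W) (hW : W.Nonempty) :
    posLaw V (farEvent t u v W) ≤ ENNReal.ofReal (8 * Real.pi / (t ^ 2 * W.card)) := by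
  have hk : (0 : ℝ) < W.card := by exact_mod_cast hW.card_pos
  rw [← lintegral_indicator_one (measurableSet_farEvent ..)]
  have h := lintegral_gaussFactor_farEvent_le ht.le W hu hv 0
  simp only [pow_zero, one_mul, zero_add] at h
  refine h.trans ((lintegral_pi_le_of_update (fun _ : V => uniform) v
    (g := fun _ => ENNReal.ofReal (8 * Real.pi / (t ^ 2 * W.card)))
    ((measurable_gaussFactor ..).pow_const _) (.of_forall fun x => ?_)).trans (by simp))
  refine (lintegral_mono' Measure.restrict_le_self le_rfl).trans (le_of_eq ?_)
  have h8 : 8 * Real.pi / (t ^ 2 * W.card) = Real.pi / (t ^ 2 / 8 * W.card) := by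
    field_simp
  rw [h8, ← lintegral_gaussian (by positivity) (x u)]
  refine lintegral_congr fun y => ?_
  simp only [gaussFactor, Function.update_self, Function.update_of_ne huv]
  rw [← ENNReal.ofReal_pow (by positivity), ← Real.exp_nat_mul]
  congr 2
  ring

open Classical in
/-- The number of ordered pairs of distinct nonadjacent vertices. -/
def numNonadj (G : SimpleGraph V) : ℕ :=
  (Finset.univ.filter fun q : V × V => q.1 ≠ q.2 ∧ ¬ G.Adj q.1 q.2).card

theorem posLaw_lt_stretchFactor_le {G : SimpleGraph V} {m : ℝ} (hm : 0 < m)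
    (hG : ∀ u v, u ≠ v → m ≤ (commonNbrs G u v).card) {t : ℝ} (ht : 0 < t) :
    posLaw V {x | ENNReal.ofReal (1 + t) < stretchFactor x G} ≤
      ENNReal.ofReal (8 * Real.pi * numNonadj G / m / t ^ 2) := by
  classical
  have hsub : {x | ENNReal.ofReal (1 + t) < stretchFactor x G} ⊆
      ⋃ q ∈ Finset.univ.filter fun q : V × V => q.1 ≠ q.2 ∧ ¬ G.Adj q.1 q.2,
        farEvent t q.1 q.2 (commonNbrs G q.1 q.2) := by
    intro x hx
    obtain ⟨u, v, huv, hadj, h⟩ := exists_of_lt_stretchFactor x ht.le hx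
    simp only [Set.mem_iUnion]
    exact ⟨(u, v), by simp [huv, hadj], h⟩
  refine (measure_mono hsub).trans ((measure_biUnion_finset_le _ _).trans ?_)
  refine (Finset.sum_le_card_nsmul _ _ (ENNReal.ofReal (8 * Real.pi / (t ^ 2 * m))) ?_).trans
    (le_of_eq ?_)
  · rintro ⟨u, v⟩ hq
    simp only [Finset.mem_filter, Finset.mem_univ, true_and] at hq
    have hmc := hG u v hq.1
    refine (posLaw_farEvent_le ht hq.1 (by simp [mem_commonNbrs]) (by simp [mem_commonNbrs])
      ?_).trans (ENNReal.ofReal_le_ofReal (by gcongr))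
    rw [← Finset.card_pos]
    exact_mod_cast hm.trans_le hmc
  · rw [nsmul_eq_mul, ← ENNReal.ofReal_natCast, ← ENNReal.ofReal_mul (by positivity)]
    congr 1
    unfold numNonadj
    field_simp

/-- Crude bound for exceptional graphs: with path lengths at most `2N`, a large stretch requires two
points within `2N / t` of each other. -/
theorem posLaw_lt_stretchFactor_le_of_connected {G : SimpleGraph V} (hG : G.Connected)
    {t : ℝ} (ht : 0 < t) :
    posLaw V {x | ENNReal.ofReal (1 + t) < stretchFactor x G} ≤
      ENNReal.ofReal (4 * Real.pi * Fintype.card V ^ 4 / t ^ 2) := by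
  classical
  set N : ℝ := (Fintype.card V : ℝ)
  have hsub : posLaw V {x | ENNReal.ofReal (1 + t) < stretchFactor x G} ≤
      posLaw V (⋃ q ∈ Finset.univ.filter fun q : V × V => q.1 ≠ q.2,
        {x | dist (x q.2) (x q.1) < 2 * N / t}) := by
    refine measure_mono_ae ?_
    filter_upwards [ae_mem_unitSquare] with x hx hlt
    obtain ⟨u, v, huv, h⟩ := exists_of_lt_stretchFactor_of_connected x hG hx ht hlt
    refine Set.mem_iUnion₂.2 ⟨(u, v), by simp [huv], h⟩
  refine hsub.trans ((measure_biUnion_finset_le _ _).trans ?_)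
  refine (Finset.sum_le_card_nsmul _ _ (ENNReal.ofReal (Real.pi * (2 * N / t) ^ 2)) ?_).trans ?_
  · rintro ⟨u, v⟩ hq
    simp only [Finset.mem_filter, Finset.mem_univ, true_and] at hq
    exact posLaw_dist_lt_le hq _
  · rw [nsmul_eq_mul, ← ENNReal.ofReal_natCast, ← ENNReal.ofReal_mul (by positivity)]
    refine ENNReal.ofReal_le_ofReal ?_
    have hc : ((Finset.univ.filter fun q : V × V => q.1 ≠ q.2).card : ℝ) ≤ N ^ 2 := by
      rw [sq]
      simp only [N]
      exact_mod_cast (Finset.card_le_univ _).trans (Fintype.card_prod V V).le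
    calc _ ≤ N ^ 2 * (Real.pi * (2 * N / t) ^ 2) := by gcongr
      _ = _ := by field_simp; ring

theorem lintegral_stretchFactor_le {G : SimpleGraph V} {m : ℝ} (hm : 0 < m)
    (hG : ∀ u v, u ≠ v → m ≤ (commonNbrs G u v).card) {s : ℝ} (hs : 0 < s) :
    ∫⁻ x, stretchFactor x G ∂posLaw V ≤
      1 + ENNReal.ofReal (s + 8 * Real.pi * numNonadj G / m / s) :=
  lintegral_le_of_tail (measurable_stretchFactor G) hs (by positivity) fun _ ht =>
    posLaw_lt_stretchFactor_le hm hG ht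

theorem lintegral_stretchFactor_le_of_connected {G : SimpleGraph V} (hG : G.Connected) :
    ∫⁻ x, stretchFactor x G ∂posLaw V ≤
      1 + ENNReal.ofReal (1 + 4 * Real.pi * Fintype.card V ^ 4) := by
  simpa using lintegral_le_of_tail (μ := posLaw V) (measurable_stretchFactor G) one_pos
    (by positivity) fun _ ht => posLaw_lt_stretchFactor_le_of_connected hG ht

end

/-! ### The binomial random graph: missing edges and common neighbours. -/

section

variable {V : Type*}

/-- As there are finitely many graphs, this makes every set of graphs measurable. -/
instance [Fintype V] : MeasurableSingletonClass (SimpleGraph V) where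
  measurableSet_singleton g := by
    have : {g} = ⋂ u, ⋂ v, {h : SimpleGraph V | h.Adj u v ↔ g.Adj u v} := by
      ext h
      simp [SimpleGraph.ext_iff, funext_iff]
    rw [this]
    refine .iInter fun u => .iInter fun v => ?_
    have h1 : Measurable fun h : SimpleGraph V => h.Adj u v := by fun_prop
    by_cases hg : g.Adj u v
    · simpa [hg] using measurableSet_setOfPred.2 h1
    · simpa [hg] using measurableSet_setOfPred.2 h1.not


/-- The law of the indicator of a potential edge. -/
abbrev edgeLaw (p : unitInterval) (e : Sym2 V) : Measure Prop :=
  unitInterval.toNNReal p • Measure.dirac (e ∈ (Sym2.diagSetᶜ : Set (Sym2 V))) +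
    unitInterval.toNNReal (unitInterval.symm p) • Measure.dirac False

theorem lintegral_edgeLaw (p : unitInterval) {e : Sym2 V} (he : ¬ e.IsDiag) (f : Prop → ℝ≥0∞) :
    ∫⁻ b, f b ∂edgeLaw p e =
      ENNReal.ofReal p * f True + ENNReal.ofReal (1 - p) * f False := by
  have h1 : (e ∈ (Sym2.diagSetᶜ : Set (Sym2 V))) = True := by simpa using he
  have h2 (q : unitInterval) : ((unitInterval.toNNReal q : NNReal) : ℝ≥0∞) = ENNReal.ofReal q := by
    rw [ENNReal.ofReal, Real.toNNReal_of_nonneg q.2.1]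
    rfl
  have h3 (a : NNReal) (μ : Measure Prop) : ∫⁻ b, f b ∂(a • μ) = a * ∫⁻ b, f b ∂μ :=
    lintegral_smul_measure (R := NNReal) a f
  rw [edgeLaw, lintegral_add_measure, h3, h3, lintegral_dirac, lintegral_dirac, h1, h2, h2]
  rfl

variable [Fintype V] [DecidableEq V]

theorem lintegral_binomialRandom (p : unitInterval) (f : SimpleGraph V → ℝ≥0∞) :
    ∫⁻ g, f g ∂SimpleGraph.binomialRandom V p =
      ∫⁻ b : Sym2 V → Prop, f (SimpleGraph.fromEdgeSet {e | b e}) ∂Measure.pi (edgeLaw p) := by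
  rw [SimpleGraph.binomialRandom_eq_map, lintegral_map .of_discrete (by fun_prop),
    setBernoulli_eq_map, lintegral_map .of_discrete .of_discrete, Measure.infinitePi_eq_pi]

theorem binomialRandom_not_adj_le (p : unitInterval) {u v : V} (huv : u ≠ v) :
    SimpleGraph.binomialRandom V p {g | ¬ g.Adj u v} ≤ ENNReal.ofReal (1 - p) := by
  classical
  rw [← lintegral_indicator_one .of_discrete, lintegral_binomialRandom]
  refine (lintegral_pi_le_of_update (edgeLaw p) s(u, v)
    (g := fun _ => ENNReal.ofReal (1 - p)) .of_discrete (.of_forall fun b => ?_)).trans (by simp)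
  rw [lintegral_edgeLaw p (by simpa using huv)]
  simp [huv]

theorem lintegral_numNonadj_le (p : unitInterval) :
    ∫⁻ g, (numNonadj g : ℝ≥0∞) ∂SimpleGraph.binomialRandom V p ≤
      ENNReal.ofReal (Fintype.card V ^ 2 * (1 - p)) := by
  classical
  have h (g : SimpleGraph V) : (numNonadj g : ℝ≥0∞) =
      ∑ q ∈ Finset.univ.filter fun q : V × V => q.1 ≠ q.2,
        {g : SimpleGraph V | ¬ g.Adj q.1 q.2}.indicator 1 g := by
    rw [numNonadj, ← Finset.filter_filter, Finset.card_filter]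
    simp [Set.indicator_apply]
  simp_rw [h]
  rw [lintegral_finsetSum _ fun _ _ => .of_discrete]
  refine (Finset.sum_le_card_nsmul _ _ (ENNReal.ofReal (1 - p)) fun q hq => ?_).trans ?_
  · rw [lintegral_indicator_one .of_discrete]
    exact binomialRandom_not_adj_le p (Finset.mem_filter.1 hq).2
  · rw [nsmul_eq_mul, ENNReal.ofReal_mul (by positivity)]
    gcongr
    rw [ENNReal.ofReal_pow (by positivity), ENNReal.ofReal_natCast, sq]
    exact_mod_cast (Finset.card_le_univ _).trans (Fintype.card_prod V V).le

/-- The edge pairs `uw`, `vw` are disjoint for different `w`, so the factors are independent, each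
of mean `1 - p² / 2`. Exposing `uw` leaves `1 - p / 2` if `vw` is present and `1` otherwise;
exposing `vw` then gives the mean. -/
theorem lintegral_prod_common_edges_le (p : unitInterval) {u v : V} (huv : u ≠ v) (W : Finset V)
    (hu : u ∉ W) (hv : v ∉ W) :
    ∫⁻ b : Sym2 V → Prop, ∏ w ∈ W, (open Classical in
        if b s(u, w) ∧ b s(v, w) then ENNReal.ofReal (1 / 2) else 1) ∂Measure.pi (edgeLaw p) ≤
      ENNReal.ofReal (1 - p ^ 2 / 2) ^ W.card := by
  classical
  have hp0 : (0 : ℝ) ≤ p := p.2.1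
  have hp1 : (p : ℝ) ≤ 1 := p.2.2
  induction W using Finset.induction_on with
  | empty => simp
  | insert w W hw ih =>
    simp only [Finset.mem_insert, not_or] at hu hv
    set R : (Sym2 V → Prop) → ℝ≥0∞ := fun b =>
      ∏ w ∈ W, if b s(u, w) ∧ b s(v, w) then ENNReal.ofReal (1 / 2) else 1 with hR
    have hRu (b : Sym2 V → Prop) (y : Prop) : R (Function.update b s(u, w) y) = R b := by
      refine Finset.prod_congr rfl fun a ha => ?_
      have haw : a ≠ w := fun h => hw (h ▸ ha)
      rw [Function.update_of_ne (by simp; grind), Function.update_of_ne (by simp; grind)]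
    have hRv (b : Sym2 V → Prop) (y : Prop) : R (Function.update b s(v, w) y) = R b := by
      refine Finset.prod_congr rfl fun a ha => ?_
      have haw : a ≠ w := fun h => hw (h ▸ ha)
      rw [Function.update_of_ne (by simp; grind), Function.update_of_ne (by simp; grind)]
    have hne : s(v, w) ≠ s(u, w) := by simp; grind
    simp_rw [Finset.prod_insert hw]
    refine (lintegral_pi_le_of_update (edgeLaw p) s(u, w)
      (g := fun b => (if b s(v, w) then ENNReal.ofReal (1 - p / 2) else 1) * R b)
      .of_discrete (.of_forall fun b => ?_)).trans ?_
    · rw [lintegral_edgeLaw p (by simpa using hu.1)]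
      change _ * (_ * R _) + _ * (_ * R _) ≤ _
      simp only [hRu, Function.update_self, Function.update_of_ne hne]
      rw [← mul_assoc, ← mul_assoc, ← add_mul]
      refine mul_le_mul' ?_ le_rfl
      by_cases h : b s(v, w)
      · simp only [h, and_self, if_true, false_and, if_false, mul_one]
        rw [← ENNReal.ofReal_mul hp0, ← ENNReal.ofReal_add (by positivity) (by linarith)]
        exact ENNReal.ofReal_le_ofReal (by linarith)
      · simp only [h, and_false, if_false, mul_one]
        rw [← ENNReal.ofReal_add hp0 (by linarith)]
        simp
    refine (lintegral_pi_le_of_update (edgeLaw p) s(v, w)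
      (g := fun b => ENNReal.ofReal (1 - p ^ 2 / 2) * R b)
      .of_discrete (.of_forall fun b => ?_)).trans ?_
    · rw [lintegral_edgeLaw p (by simpa using hv.1)]
      simp only [hRv, Function.update_self]
      rw [← mul_assoc, ← mul_assoc, ← add_mul]
      refine mul_le_mul' ?_ le_rfl
      simp only [if_true, if_false, mul_one]
      rw [← ENNReal.ofReal_mul hp0,
        ← ENNReal.ofReal_add (mul_nonneg hp0 (by linarith)) (by linarith)]
      exact ENNReal.ofReal_le_ofReal (by nlinarith)
    · rw [lintegral_const_mul _ .of_discrete, Finset.card_insert_of_notMem hw,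
        pow_succ' (ENNReal.ofReal _)]
      exact mul_le_mul' le_rfl (ih hu.2 hv.2)

theorem lintegral_half_pow_card_commonNbrs_le (p : unitInterval) {u v : V} (huv : u ≠ v) :
    ∫⁻ g, ENNReal.ofReal (1 / 2) ^ (commonNbrs g u v).card ∂SimpleGraph.binomialRandom V p ≤
      ENNReal.ofReal (1 - p ^ 2 / 2) ^ (Fintype.card V - 2) := by
  classical
  rw [lintegral_binomialRandom]
  have hcard : ({u, v}ᶜ : Finset V).card = Fintype.card V - 2 := by
    rw [Finset.card_compl, Finset.card_pair huv]
  rw [← hcard]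
  refine le_trans (le_of_eq ?_)
    (lintegral_prod_common_edges_le p huv {u, v}ᶜ (by simp) (by simp))
  refine lintegral_congr fun b => ?_
  rw [Finset.prod_ite, Finset.prod_const, Finset.prod_const_one, mul_one]
  congr 2
  ext w
  simp only [mem_commonNbrs, SimpleGraph.fromEdgeSet_adj, Set.mem_ofPred_eq, Finset.mem_filter,
    Finset.mem_compl, Finset.mem_insert, Finset.mem_singleton]
  grind

/-- Chernoff bound: Markov's inequality applied to `2^(-X)`, where `X` is the number of common
neighbours. -/
theorem binomialRandom_card_commonNbrs_lt_le (p : unitInterval) {u v : V} (huv : u ≠ v) :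
    SimpleGraph.binomialRandom V p
        {g | ((commonNbrs g u v).card : ℝ) < (p : ℝ) ^ 2 * Fintype.card V / 8} ≤
      ENNReal.ofReal (Real.exp (1 - 2 / 5 * ((p : ℝ) ^ 2 * Fintype.card V))) := by
  have hp0 : (0 : ℝ) ≤ p := p.2.1
  have hp1 : (p : ℝ) ≤ 1 := p.2.2
  set a : ℝ := (p : ℝ) ^ 2 * Fintype.card V with ha
  have ha0 : 0 ≤ a := by positivity
  have hp2 : (p : ℝ) ^ 2 ≤ 1 := pow_le_one₀ hp0 hp1
  rw [← lintegral_indicator_one .of_discrete]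
  have hpt (g : SimpleGraph V) :
      {g | ((commonNbrs g u v).card : ℝ) < a / 8}.indicator (1 : SimpleGraph V → ℝ≥0∞) g ≤
        ENNReal.ofReal ((2 : ℝ) ^ (a / 8)) *
          ENNReal.ofReal (1 / 2) ^ (commonNbrs g u v).card := by
    rw [Set.indicator_apply]
    split_ifs with hg
    swap
    · exact zero_le
    rw [← ENNReal.ofReal_pow (by positivity), ← ENNReal.ofReal_mul (by positivity), Pi.one_apply,
      ENNReal.one_le_ofReal, ← Real.rpow_natCast, one_div, Real.inv_rpow two_pos.le,
      ← div_eq_mul_inv, one_le_div (by positivity)]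
    exact Real.rpow_le_rpow_of_exponent_le one_le_two (le_of_lt hg)
  refine (lintegral_mono hpt).trans ?_
  rw [lintegral_const_mul _ .of_discrete]
  refine (mul_le_mul' le_rfl (lintegral_half_pow_card_commonNbrs_le p huv)).trans ?_
  rw [← ENNReal.ofReal_pow (by linarith), ← ENNReal.ofReal_mul (by positivity)]
  refine ENNReal.ofReal_le_ofReal ?_
  have h1 : (1 - (p : ℝ) ^ 2 / 2) ^ (Fintype.card V - 2) ≤ Real.exp (1 - a / 2) := by
    calc (1 - (p : ℝ) ^ 2 / 2) ^ (Fintype.card V - 2)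
        ≤ Real.exp (-((p : ℝ) ^ 2 / 2)) ^ (Fintype.card V - 2) := by
          gcongr
          · linarith
          · linarith [Real.add_one_le_exp (-((p : ℝ) ^ 2 / 2))]
      _ = Real.exp ((Fintype.card V - 2 : ℕ) * (-((p : ℝ) ^ 2 / 2))) := (Real.exp_nat_mul _ _).symm
      -- Having `n - 2` in place of `n` costs `p² ≤ 1` in the exponent, hence the summand 1.
      _ ≤ _ := by
          refine Real.exp_le_exp.2 ?_
          have : (Fintype.card V : ℝ) ≤ (Fintype.card V - 2 : ℕ) + 2 := by
            exact_mod_cast (by omega : Fintype.card V ≤ Fintype.card V - 2 + 2)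
          nlinarith [sq_nonneg (p : ℝ)]
  calc (2 : ℝ) ^ (a / 8) * (1 - (p : ℝ) ^ 2 / 2) ^ (Fintype.card V - 2)
      ≤ Real.exp (Real.log 2 * (a / 8)) * Real.exp (1 - a / 2) := by
        rw [Real.rpow_def_of_pos two_pos]
        gcongr
    _ ≤ _ := by
        rw [← Real.exp_add]
        refine Real.exp_le_exp.2 ?_
        -- The rate `2/5` is `1/2 - 1/10`, as `log 2 / 8 < 1/10`.
        nlinarith [Real.log_two_lt_d9]

/-- The graphs in which any two vertices have at least `p ^ 2 * n / 8` common neighbours. -/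
def manyCommonNbrs (V : Type*) [Fintype V] (p : unitInterval) : Set (SimpleGraph V) :=
  {g | ∀ u v, u ≠ v → (p : ℝ) ^ 2 * Fintype.card V / 8 ≤ (commonNbrs g u v).card}

theorem binomialRandom_compl_manyCommonNbrs_le (p : unitInterval) :
    SimpleGraph.binomialRandom V p (manyCommonNbrs V p)ᶜ ≤
      ENNReal.ofReal (Fintype.card V ^ 2 *
        Real.exp (1 - 2 / 5 * ((p : ℝ) ^ 2 * Fintype.card V))) := by
  have hsub : (manyCommonNbrs V p)ᶜ ⊆ ⋃ q ∈ Finset.univ.filter fun q : V × V => q.1 ≠ q.2,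
      {g | ((commonNbrs g q.1 q.2).card : ℝ) < (p : ℝ) ^ 2 * Fintype.card V / 8} := by
    intro g hg
    simp only [manyCommonNbrs, Set.mem_compl_iff, Set.mem_ofPred_eq, not_forall, not_le] at hg
    obtain ⟨u, v, huv, h⟩ := hg
    exact Set.mem_iUnion₂.2 ⟨(u, v), by simp [huv], h⟩
  refine (measure_mono hsub).trans ((measure_biUnion_finset_le _ _).trans ?_)
  refine (Finset.sum_le_card_nsmul _ _ _ fun q hq =>
    binomialRandom_card_commonNbrs_lt_le p (Finset.mem_filter.1 hq).2).trans ?_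
  rw [nsmul_eq_mul, ENNReal.ofReal_mul (by positivity)]
  gcongr
  rw [ENNReal.ofReal_pow (by positivity), ENNReal.ofReal_natCast, sq]
  exact_mod_cast (Finset.card_le_univ _).trans (Fintype.card_prod V V).le

omit [DecidableEq V] in
theorem connected_of_mem_manyCommonNbrs [Nonempty V] {p : unitInterval} (hp : 0 < (p : ℝ))
    {g : SimpleGraph V} (hg : g ∈ manyCommonNbrs V p) : g.Connected := by
  refine connected_of_commonNbrs_nonempty fun u v huv => Finset.card_pos.1 ?_
  have h : 0 < (p : ℝ) ^ 2 * Fintype.card V / 8 := by positivity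
  exact_mod_cast h.trans_le (hg u v huv)

end

/-! ### Averaging over both the graph and the positions. -/

section

variable {n : ℕ} {p : unitInterval}

theorem law_eq (n : ℕ) (p : unitInterval) :
    law n p = (posLaw (Fin n)).prod (SimpleGraph.binomialRandom (Fin n) p) := rfl

instance : IsProbabilityMeasure (law n p) := by
  rw [law_eq]
  infer_instance

theorem measurable_F : Measurable (F : Sample n → ℝ≥0∞) :=
  measurable_from_prod_countable_left fun g => measurable_stretchFactor g

theorem law_snd_preimage (S : Set (SimpleGraph (Fin n))) :
    law n p (Prod.snd ⁻¹' S) = SimpleGraph.binomialRandom (Fin n) p S := by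
  rw [law_eq, ← Set.univ_prod, Measure.prod_prod, measure_univ, one_mul]

theorem measurableSet_CON : MeasurableSet (CON n) :=
  measurable_snd (MeasurableSet.of_discrete (s := {g : SimpleGraph (Fin n) | g.Connected}))

theorem aas_of_tendsto_compl {p : ℕ → unitInterval} {E : ∀ n, Set (Sample n)}
    (hE : ∀ n, MeasurableSet (E n))
    (h : Tendsto (fun n => law n (p n) (E n)ᶜ) atTop (𝓝 0)) : AAS p E := by
  have h1 : Tendsto (fun n => 1 - law n (p n) (E n)ᶜ) atTop (𝓝 (1 - 0)) :=
    ENNReal.Tendsto.sub tendsto_const_nhds h (.inl ENNReal.one_ne_top)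
  rw [tsub_zero] at h1
  refine h1.congr fun n => ?_
  rw [← prob_compl_eq_one_sub (hE n).compl, compl_compl]

theorem AAS.mono {p : ℕ → unitInterval} {E E' : ∀ n, Set (Sample n)} (h : AAS p E)
    (hE : ∀ᶠ n in atTop, E n ⊆ E' n) : AAS p E' :=
  tendsto_of_tendsto_of_tendsto_of_le_of_le' h tendsto_const_nhds
    (hE.mono fun _ hn => measure_mono hn) (.of_forall fun _ => prob_le_one)

theorem lintegral_numNonadj_mul_le (hn : 0 < n) (hp : 0 < (p : ℝ)) {c : ℝ} (hc : 0 < c) :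
    ∫⁻ g, ENNReal.ofReal (8 * Real.pi * numNonadj g / ((p : ℝ) ^ 2 * n / 8) / c)
        ∂SimpleGraph.binomialRandom (Fin n) p ≤
      ENNReal.ofReal (64 * Real.pi * (n * (1 - p)) / ((p : ℝ) ^ 2 * c)) := by
  have hn' : (0 : ℝ) < n := by exact_mod_cast hn
  have h (g : SimpleGraph (Fin n)) :
      ENNReal.ofReal (8 * Real.pi * numNonadj g / ((p : ℝ) ^ 2 * n / 8) / c) =
        ENNReal.ofReal (64 * Real.pi / ((p : ℝ) ^ 2 * n * c)) * numNonadj g := by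
    rw [← ENNReal.ofReal_natCast, ← ENNReal.ofReal_mul (by positivity)]
    congr 1
    field_simp
    ring
  simp_rw [h]
  rw [lintegral_const_mul _ .of_discrete]
  refine (mul_le_mul' le_rfl (lintegral_numNonadj_le p)).trans ?_
  rw [← ENNReal.ofReal_mul (by positivity), Fintype.card_fin]
  refine ENNReal.ofReal_le_ofReal (le_of_eq ?_)
  field_simp

theorem law_compl_connected_stretch_le (hn : 0 < n) (hp : 0 < (p : ℝ)) {t : ℝ} (ht : 0 < t) :
    law n p {ω | ω ∈ CON n ∧ F ω ≤ ENNReal.ofReal (1 + t)}ᶜ ≤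
      SimpleGraph.binomialRandom (Fin n) p (manyCommonNbrs (Fin n) p)ᶜ +
        ENNReal.ofReal (64 * Real.pi * (n * (1 - p)) / ((p : ℝ) ^ 2 * t ^ 2)) := by
  have : Nonempty (Fin n) := ⟨⟨0, hn⟩⟩
  set M := manyCommonNbrs (Fin n) p
  set T : Set (Sample n) := {ω | ω.2 ∈ M ∧ ENNReal.ofReal (1 + t) < F ω} with hT
  have hTm : MeasurableSet T := (measurable_snd (MeasurableSet.of_discrete (s := M))).inter
    (measurableSet_lt measurable_const measurable_F)
  have hsub : {ω | ω ∈ CON n ∧ F ω ≤ ENNReal.ofReal (1 + t)}ᶜ ⊆ Prod.snd ⁻¹' Mᶜ ∪ T := by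
    intro ω hω
    by_cases hM : ω.2 ∈ M
    · refine .inr ⟨hM, ?_⟩
      by_contra hle
      exact hω ⟨connected_of_mem_manyCommonNbrs hp hM, not_lt.1 hle⟩
    · exact .inl hM
  refine (measure_mono hsub).trans ((measure_union_le _ _).trans ?_)
  rw [law_snd_preimage]
  gcongr
  rw [law_eq, Measure.prod_apply_symm hTm]
  refine le_trans (lintegral_mono fun g => ?_)
    (lintegral_numNonadj_mul_le hn hp (by positivity : 0 < t ^ 2))
  by_cases hg : g ∈ M
  · refine (measure_mono fun x hx => hx.2).trans
      (posLaw_lt_stretchFactor_le (by positivity) (fun u v huv => ?_) ht)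
    simpa using hg u v huv
  · have : (fun x => (x, g)) ⁻¹' T = ∅ := by
      ext x
      simp [hT, hg]
    simp [this]

/-- For `p = 1` the threshold is `t = 0`, where the tail bound says nothing; but the graph is almost
surely complete. -/
theorem law_one_compl_connected_stretch (hn : 0 < n) :
    law n 1 {ω | ω ∈ CON n ∧ F ω ≤ 1}ᶜ = 0 := by
  have : Nonempty (Fin n) := ⟨⟨0, hn⟩⟩
  have hsub : {ω | ω ∈ CON n ∧ F ω ≤ 1}ᶜ ⊆ Prod.snd ⁻¹' {(⊤ : SimpleGraph (Fin n))}ᶜ := by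
    rintro ⟨x, g⟩ hω rfl
    refine hω ⟨SimpleGraph.connected_top, not_lt.1 fun hlt => ?_⟩
    obtain ⟨u, v, huv, hadj, -⟩ := exists_of_lt_stretchFactor x le_rfl
      (by simpa [F] using hlt : ENNReal.ofReal (1 + 0) < stretchFactor x ⊤)
    exact hadj huv
  refine measure_mono_null hsub ?_
  rw [law_snd_preimage, SimpleGraph.binomialRandom_one]
  simp

theorem setLIntegral_CON_F_le (hn : 0 < n) (hp : 0 < (p : ℝ)) {s η : ℝ} (hs : 0 < s)
    (hη : SimpleGraph.binomialRandom (Fin n) p (manyCommonNbrs (Fin n) p)ᶜ ≤ ENNReal.ofReal η)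
    (hη0 : 0 ≤ η) :
    ∫⁻ ω in CON n, F ω ∂law n p ≤ law n p (CON n) +
      ENNReal.ofReal (s + 64 * Real.pi * (n * (1 - p)) / ((p : ℝ) ^ 2 * s) +
        η * (1 + 4 * Real.pi * n ^ 4)) := by
  classical
  have hp1 : 0 ≤ 1 - (p : ℝ) := sub_nonneg.2 p.2.2
  set M := manyCommonNbrs (Fin n) p
  set C : Set (SimpleGraph (Fin n)) := {g | g.Connected}
  -- The sharp bound serves graphs in `M`, the crude one connected graphs outside `M`. The leading 1
  -- is charged only to connected graphs, so that it sums to exactly the probability of `CON`.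
  have hpt (g : SimpleGraph (Fin n)) :
      ∫⁻ x, (CON n).indicator F (x, g) ∂posLaw (Fin n) ≤
        C.indicator 1 g + (ENNReal.ofReal s +
          ENNReal.ofReal (8 * Real.pi * numNonadj g / ((p : ℝ) ^ 2 * n / 8) / s)) +
          ENNReal.ofReal (1 + 4 * Real.pi * n ^ 4) * Mᶜ.indicator 1 g := by
    by_cases hg : g ∈ C
    · have h1 (x : Fin n → Plane) : (CON n).indicator F (x, g) = stretchFactor x g :=
        Set.indicator_of_mem (s := CON n) hg F
      simp_rw [h1]
      rw [Set.indicator_of_mem hg, Pi.one_apply]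
      by_cases hgM : g ∈ M
      · refine le_add_right ?_
        rw [← ENNReal.ofReal_add hs.le (by positivity)]
        refine lintegral_stretchFactor_le (by positivity) (fun u v huv => ?_) hs
        simpa using hgM u v huv
      · rw [Set.indicator_of_mem (show g ∈ Mᶜ from hgM), Pi.one_apply, mul_one, add_right_comm]
        refine le_add_right ?_
        simpa using lintegral_stretchFactor_le_of_connected (V := Fin n) hg
    · have h1 (x : Fin n → Plane) : (CON n).indicator F (x, g) = 0 :=
        Set.indicator_of_notMem (s := CON n) hg F
      simp [h1]
  rw [← lintegral_indicator measurableSet_CON, law_eq,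
    lintegral_prod_symm' _ (measurable_F.indicator measurableSet_CON), ← law_eq]
  refine (lintegral_mono hpt).trans ?_
  rw [lintegral_add_left .of_discrete, lintegral_add_left .of_discrete,
    lintegral_add_left .of_discrete, lintegral_indicator_one .of_discrete,
    lintegral_const_mul _ .of_discrete, lintegral_indicator_one .of_discrete, lintegral_const,
    measure_univ, mul_one, add_assoc,
    ENNReal.ofReal_add (q := η * (1 + 4 * Real.pi * n ^ 4)) (by positivity) (by positivity),
    ENNReal.ofReal_add hs.le (by positivity), ENNReal.ofReal_mul hη0,
    mul_comm (ENNReal.ofReal η)]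
  refine add_le_add (law_snd_preimage C).ge (add_le_add (add_le_add le_rfl ?_) ?_)
  · exact lintegral_numNonadj_mul_le hn hp hs
  · exact mul_le_mul' le_rfl hη

/-- Conditioning normalises the main term to exactly 1; only the excess `b` is multiplied by `3/2`.
-/
theorem expectationGivenCON_le {b : ℝ} (hb : 0 ≤ b)
    (hC : ENNReal.ofReal (2 / 3) ≤ law n p (CON n))
    (h : ∫⁻ ω in CON n, F ω ∂law n p ≤ law n p (CON n) + ENNReal.ofReal b) :
    expectationGivenCON n p ≤ ENNReal.ofReal (1 + 3 / 2 * b) := by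
  have h0 : law n p (CON n) ≠ 0 :=
    ((ENNReal.ofReal_pos.2 (by norm_num : (0 : ℝ) < 2 / 3)).trans_le hC).ne'
  rw [expectationGivenCON, ProbabilityTheory.cond, lintegral_smul_measure, smul_eq_mul]
  refine (mul_le_mul' le_rfl h).trans ?_
  rw [mul_add, ENNReal.inv_mul_cancel h0 (measure_ne_top _ _), ENNReal.ofReal_add zero_le_one
    (by positivity), ENNReal.ofReal_one, ENNReal.ofReal_mul (by norm_num)]
  gcongr
  refine (ENNReal.inv_le_inv.2 hC).trans ?_
  rw [← ENNReal.ofReal_inv_of_pos (by norm_num)]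
  norm_num

theorem binomialRandom_compl_manyCommonNbrs_le_of_log_le (hn : 0 < n)
    (h : 33 * Real.log n ≤ (p : ℝ) ^ 2 * n) :
    SimpleGraph.binomialRandom (Fin n) p (manyCommonNbrs (Fin n) p)ᶜ ≤
      ENNReal.ofReal (3 / n ^ 5) := by
  have hn' : (0 : ℝ) < n := by exact_mod_cast hn
  have hlog : 0 ≤ Real.log n := Real.log_natCast_nonneg n
  refine (binomialRandom_compl_manyCommonNbrs_le p).trans (ENNReal.ofReal_le_ofReal ?_)
  rw [Fintype.card_fin]
  -- Since `33 · 2/5 > 7` and `e < 3`. The pairs cost `n²`, and the remaining `n⁻⁵` beats the crude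
  -- `n⁴`.
  have h1 : Real.exp (1 - 2 / 5 * ((p : ℝ) ^ 2 * n)) ≤ 3 / n ^ 7 := by
    calc _ ≤ Real.exp (1 - (7 : ℕ) * Real.log n) := by
          refine Real.exp_le_exp.2 ?_
          push_cast
          linarith
      _ = Real.exp 1 / n ^ 7 := by
          rw [Real.exp_sub, Real.exp_nat_mul, Real.exp_log hn']
      _ ≤ _ := by
          gcongr
          linarith [Real.exp_one_lt_d9]
  calc (n : ℝ) ^ 2 * Real.exp (1 - 2 / 5 * ((p : ℝ) ^ 2 * n)) ≤ n ^ 2 * (3 / n ^ 7) := by gcongr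
    _ = _ := by field_simp

theorem pos_of_log_le (hn : 2 ≤ n) (h : 33 * Real.log n ≤ (p : ℝ) ^ 2 * n) : 0 < (p : ℝ) := by
  have hlog : 0 < Real.log n := Real.log_pos (by exact_mod_cast hn)
  rcases p.2.1.eq_or_lt with h0 | h0
  · rw [← h0] at h
    norm_num at h
    linarith
  · exact h0

theorem aas_stretch_le (p : ℕ → unitInterval)
    (h : ∀ᶠ n : ℕ in atTop, 33 * Real.log n ≤ (p n : ℝ) ^ 2 * n) {w : ℕ → ℝ}
    (hw : Tendsto w atTop atTop) :
    AAS p fun n => {ω | ω ∈ CON n ∧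
      F ω ≤ ENNReal.ofReal (1 + w n * √(n * (1 - (p n : ℝ))) / (p n : ℝ))} := by
  refine aas_of_tendsto_compl
    (fun n => measurableSet_CON.inter (measurableSet_le measurable_F measurable_const)) ?_
  have hlim : Tendsto (fun n : ℕ => ENNReal.ofReal (3 / n ^ 5) +
      ENNReal.ofReal (64 * Real.pi / w n ^ 2)) atTop (𝓝 0) := by
    rw [← add_zero (0 : ℝ≥0∞), ← ENNReal.ofReal_zero]
    refine .add (ENNReal.tendsto_ofReal ?_) (ENNReal.tendsto_ofReal ?_)
    · exact tendsto_const_nhds.div_atTop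
        ((tendsto_pow_atTop (by norm_num)).comp tendsto_natCast_atTop_atTop)
    · exact tendsto_const_nhds.div_atTop ((tendsto_pow_atTop (by norm_num)).comp hw)
  refine tendsto_of_tendsto_of_tendsto_of_le_of_le' tendsto_const_nhds hlim
    (.of_forall fun _ => zero_le) ?_
  filter_upwards [h, eventually_ge_atTop 2, hw.eventually_gt_atTop 0] with n hn hn2 hwn
  have hp := pos_of_log_le hn2 hn
  have hn' : (0 : ℝ) < n := by exact_mod_cast (by omega : 0 < n)
  rcases (p n).2.2.eq_or_lt with h1 | h1
  · have h1' : p n = 1 := Subtype.ext h1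
    rw [h1']
    simp only [Set.Icc.coe_one, sub_self, mul_zero, Real.sqrt_zero, zero_div, add_zero,
      ENNReal.ofReal_one]
    rw [law_one_compl_connected_stretch (by omega)]
    exact zero_le
  · have hq : 0 < (n : ℝ) * (1 - p n) := mul_pos hn' (sub_pos.2 h1)
    refine (law_compl_connected_stretch_le (by omega) hp (by positivity)).trans
      (add_le_add (binomialRandom_compl_manyCommonNbrs_le_of_log_le (by omega) hn)
        (ENNReal.ofReal_le_ofReal (le_of_eq ?_)))
    rw [div_pow, mul_pow, Real.sq_sqrt hq.le]
    have h1p : 1 - (p n : ℝ) ≠ 0 := (sub_pos.2 h1).ne'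
    field_simp

theorem law_CON_ge (hn : 2 ≤ n) (h : 33 * Real.log n ≤ (p : ℝ) ^ 2 * n) :
    ENNReal.ofReal (2 / 3) ≤ law n p (CON n) := by
  have : Nonempty (Fin n) := ⟨⟨0, by omega⟩⟩
  have hsub : Prod.snd ⁻¹' manyCommonNbrs (Fin n) p ⊆ CON n := fun ω hω =>
    connected_of_mem_manyCommonNbrs (pos_of_log_le hn h) hω
  refine le_trans ?_ (measure_mono hsub)
  rw [law_snd_preimage, ← compl_compl (manyCommonNbrs (Fin n) p),
    prob_compl_eq_one_sub .of_discrete]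
  refine le_trans ?_ (tsub_le_tsub_left
    (binomialRandom_compl_manyCommonNbrs_le_of_log_le (by omega) h) 1)
  rw [← ENNReal.ofReal_one, ← ENNReal.ofReal_sub _ (by positivity)]
  refine ENNReal.ofReal_le_ofReal ?_
  have h2 : (2 : ℝ) ^ 5 ≤ n ^ 5 := by gcongr; exact_mod_cast hn
  have : 3 / (n : ℝ) ^ 5 ≤ 3 / 2 ^ 5 := by gcongr
  norm_num at this ⊢
  linarith

theorem expectationGivenCON_le_of_log_le (hn : 2 ≤ n) (h : 33 * Real.log n ≤ (p : ℝ) ^ 2 * n) :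
    expectationGivenCON n p ≤
      ENNReal.ofReal (1 + √(2048 * n * (1 - (p : ℝ))) / (p : ℝ) + 100 / n) := by
  have hp := pos_of_log_le hn h
  have hp1 : 0 ≤ 1 - (p : ℝ) := sub_nonneg.2 p.2.2
  have hn1 : (1 : ℝ) ≤ n := by exact_mod_cast (by omega : 1 ≤ n)
  have hn' : (0 : ℝ) < n := by linarith
  set A : ℝ := √(n * (1 - (p : ℝ))) / p with hA
  have hA0 : 0 ≤ A := by positivity
  have hA2 : A ^ 2 = n * (1 - p) / (p : ℝ) ^ 2 := by
    rw [hA, div_pow, Real.sq_sqrt (by positivity)]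
  -- The optimal cut-off is `√(64π) A`, about `14.2 A`; the term `1 / n` keeps `s` positive when `A
  -- = 0`.
  set s : ℝ := 15 * A + 1 / n with hs
  have hs0 : 0 < s := by positivity
  have h1 : 64 * Real.pi * (n * (1 - p)) / ((p : ℝ) ^ 2 * s) ≤ 27 / 2 * A := by
    have : 64 * Real.pi * (n * (1 - p)) / ((p : ℝ) ^ 2 * s) = 64 * Real.pi * A ^ 2 / s := by
      rw [hA2]
      field_simp
    rw [this, div_le_iff₀ hs0, hs]
    have hpi := Real.pi_lt_d2
    have : 0 ≤ A * (1 / n) := by positivity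
    nlinarith [sq_nonneg A]
  have h2 : 3 / (n : ℝ) ^ 5 * (1 + 4 * Real.pi * n ^ 4) ≤ 41 / n := by
    have h5 : 3 / (n : ℝ) ^ 5 ≤ 3 / n := by
      gcongr
      exact le_self_pow₀ hn1 (by norm_num)
    have h6 : 3 / (n : ℝ) ^ 5 * (1 + 4 * Real.pi * n ^ 4) = 3 / n ^ 5 + 12 * Real.pi / n := by
      field_simp
      ring
    have h7 : 12 * Real.pi / n ≤ 38 / n := by
      gcongr
      linarith [Real.pi_lt_d2]
    calc _ ≤ 3 / (n : ℝ) + 38 / n := by rw [h6]; gcongr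
      _ = 41 / n := by rw [← add_div]; norm_num
  refine (expectationGivenCON_le (by positivity) (law_CON_ge hn h)
    (setLIntegral_CON_F_le (by omega) hp hs0
      (binomialRandom_compl_manyCommonNbrs_le_of_log_le (by omega) h) (by positivity))).trans
    (ENNReal.ofReal_le_ofReal ?_)
  have h3 : √(2048 * n * (1 - (p : ℝ))) / (p : ℝ) = √2048 * A := by
    rw [hA, mul_assoc, Real.sqrt_mul (by norm_num), mul_div_assoc]
  have h4 : (45 : ℝ) ≤ √2048 := Real.le_sqrt_of_sq_le (by norm_num)
  have h5 : 45 * A ≤ √2048 * A := by gcongr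
  rw [h3]
  have h6 : (1 : ℝ) / n = 1 * (1 / n) := by ring
  have h7 : (41 : ℝ) / n = 41 * (1 / n) := by ring
  have h8 : (100 : ℝ) / n = 100 * (1 / n) := by ring
  have h9 : (0 : ℝ) < 1 / n := by positivity
  rw [h7] at h2
  rw [h8]
  linarith

theorem eventually_log_le_of_tendsto {p : ℕ → unitInterval}
    (h : Tendsto (fun n : ℕ => (n : ℝ) * (1 - (p n : ℝ))) atTop (𝓝 0)) :
    ∀ᶠ n : ℕ in atTop, 1 / 2 ≤ (p n : ℝ) ∧ 113 * Real.log n ≤ (p n : ℝ) ^ 2 * n := by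
  -- `452 = 4 · 113`, where the 4 comes from `p² ≥ 1/4`.
  have hlog := (Real.isLittleO_log_id_atTop.comp_tendsto tendsto_natCast_atTop_atTop).bound
    (by norm_num : (0 : ℝ) < 1 / 452)
  filter_upwards [h.eventually_lt_const one_pos, eventually_ge_atTop 2, hlog] with n hn hn2 hl
  have hn2' : (2 : ℝ) ≤ n := by exact_mod_cast hn2
  have hhalf : 1 / 2 ≤ (p n : ℝ) := by
    by_contra! hlt
    nlinarith
  refine ⟨hhalf, ?_⟩
  simp only [Function.comp_apply, id, Real.norm_eq_abs] at hl
  rw [abs_of_nonneg (Real.log_natCast_nonneg n), abs_of_nonneg (by positivity)] at hl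
  nlinarith

end

end RandomEmbeddedGraph

end

/-! ### Assembly of the three statements. -/

theorem theorem2 (p : ℕ → unitInterval) :
    -- the bound in probability
    ((∀ᶠ n : ℕ in atTop, 33 * Real.log n ≤ (p n : ℝ) ^ 2 * n) →
      ∀ w : ℕ → ℝ, Tendsto w atTop atTop →
        RandomEmbeddedGraph.AAS p fun n =>
          {ω | ω ∈ RandomEmbeddedGraph.CON n ∧
            RandomEmbeddedGraph.F ω ≤
              ENNReal.ofReal (1 + w n * √(n * (1 - (p n : ℝ))) / (p n : ℝ))}) ∧
    -- the bound on the conditional expectation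
    ((∀ᶠ n : ℕ in atTop, 113 * Real.log n ≤ (p n : ℝ) ^ 2 * n) →
      ∃ o : ℕ → ℝ, Tendsto o atTop (𝓝 0) ∧
        ∀ᶠ n : ℕ in atTop,
          0 < RandomEmbeddedGraph.law n (p n) (RandomEmbeddedGraph.CON n) ∧
          RandomEmbeddedGraph.expectationGivenCON n (p n) ≤
            ENNReal.ofReal (1 + √(2048 * n * (1 - (p n : ℝ))) / (p n : ℝ) + o n)) ∧
    -- the case of few missing edges
    (Tendsto (fun n : ℕ => (n : ℝ) * (1 - (p n : ℝ))) atTop (𝓝 0) →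
      ∀ ε : ℝ, 0 < ε →
        (RandomEmbeddedGraph.AAS p fun n =>
          {ω | ω ∈ RandomEmbeddedGraph.CON n ∧
            RandomEmbeddedGraph.F ω < ENNReal.ofReal (1 + ε)}) ∧
        ∀ᶠ n : ℕ in atTop,
          0 < RandomEmbeddedGraph.law n (p n) (RandomEmbeddedGraph.CON n) ∧
          RandomEmbeddedGraph.expectationGivenCON n (p n) ≤ ENNReal.ofReal (1 + ε)) := by
  have hexp : (∀ᶠ n : ℕ in atTop, 113 * Real.log n ≤ (p n : ℝ) ^ 2 * n) →
      ∀ᶠ n : ℕ in atTop,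
        0 < RandomEmbeddedGraph.law n (p n) (RandomEmbeddedGraph.CON n) ∧
        RandomEmbeddedGraph.expectationGivenCON n (p n) ≤
          ENNReal.ofReal (1 + √(2048 * n * (1 - (p n : ℝ))) / (p n : ℝ) + 100 / n) := by
    intro h
    filter_upwards [h, eventually_ge_atTop 2] with n hn hn2
    have h33 : 33 * Real.log n ≤ (p n : ℝ) ^ 2 * n := by
      linarith [Real.log_natCast_nonneg n]
    exact ⟨(ENNReal.ofReal_pos.2 (by norm_num)).trans_le
      (RandomEmbeddedGraph.law_CON_ge hn2 h33),
      RandomEmbeddedGraph.expectationGivenCON_le_of_log_le hn2 h33⟩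
  have hinv : Tendsto (fun n : ℕ => (100 : ℝ) / n) atTop (𝓝 0) :=
    tendsto_const_nhds.div_atTop tendsto_natCast_atTop_atTop
  refine ⟨fun h w hw => RandomEmbeddedGraph.aas_stretch_le p h hw,
    fun h => ⟨fun n => 100 / n, hinv, hexp h⟩, fun h ε hε => ?_⟩
  have hlog := RandomEmbeddedGraph.eventually_log_le_of_tendsto h
  have hsqrt : Tendsto (fun n : ℕ => √((n : ℝ) * (1 - (p n : ℝ)))) atTop (𝓝 0) := by
    simpa using h.sqrt
  constructor
  -- The summand `1 / (n + 1)` keeps `a` positive, so that `w = ε / (4a)` tends to infinity. With `p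
  -- ≥ 1/2` the excess `w √(n(1-p)) / p` is then at most `ε / 2`.
  · set a : ℕ → ℝ := fun n => √((n : ℝ) * (1 - (p n : ℝ))) + 1 / (n + 1)
    have ha0 (n : ℕ) : 0 < a n := by positivity
    have ha : Tendsto a atTop (𝓝[>] 0) := by
      refine tendsto_nhdsWithin_iff.2 ⟨?_, .of_forall ha0⟩
      rw [← add_zero (0 : ℝ)]
      exact hsqrt.add tendsto_one_div_add_atTop_nhds_zero_nat
    have hw : Tendsto (fun n => ε / 4 * (a n)⁻¹) atTop atTop :=
      (tendsto_inv_nhdsGT_zero.comp ha).const_mul_atTop (by positivity)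
    refine (RandomEmbeddedGraph.aas_stretch_le p (hlog.mono fun n hn => ?_) hw).mono ?_
    · linarith [hn.2, Real.log_natCast_nonneg n]
    · filter_upwards [hlog] with n hn ω hω
      refine ⟨hω.1, hω.2.trans_lt ((ENNReal.ofReal_lt_ofReal_iff (by positivity)).2 ?_)⟩
      have h1 : (a n)⁻¹ * √((n : ℝ) * (1 - (p n : ℝ))) ≤ 1 := by
        rw [inv_mul_le_one₀ (ha0 n)]
        exact le_add_of_nonneg_right (by positivity)
      have h2 : ε / 4 * (a n)⁻¹ * √((n : ℝ) * (1 - (p n : ℝ))) / p n ≤ ε / 4 / (1 / 2) := by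
        gcongr
        · exact mul_assoc (ε / 4) _ _ ▸ mul_le_of_le_one_right (by positivity) h1
        · exact hn.1
      linarith
  · have hsum : Tendsto (fun n : ℕ => √2048 * √((n : ℝ) * (1 - (p n : ℝ))) / (1 / 2) + 100 / n)
        atTop (𝓝 0) := by
      simpa using ((hsqrt.const_mul (√2048)).div_const (1 / 2)).add hinv
    filter_upwards [hlog, hexp (hlog.mono fun n hn => hn.2), hsum.eventually_lt_const hε]
      with n hn he hlt
    refine ⟨he.1, he.2.trans (ENNReal.ofReal_le_ofReal ?_)⟩
    have h1 : √(2048 * n * (1 - (p n : ℝ))) / p n ≤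
        √2048 * √((n : ℝ) * (1 - (p n : ℝ))) / (1 / 2) := by
      rw [mul_assoc, Real.sqrt_mul (by norm_num)]
      gcongr
      exact hn.1
    linarith
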